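/- A directed graph is a structure with one binary relation that is irreflexive and antisymmetric (no loops, no two-way edges). An $\omega$-partite tournament is a directed graph whose vertex set can be partitioned into pairwise disjoint, possibly empty sets $A_1, A_2, \ldots$ (its parts) such that any two vertices in different parts are joined by an edge and there are no edges between vertices in the same part. It is a semigeneric tournament if for any two different parts $X$ and $Y$, all $a \neq b$ in $X$ and all $c \neq d$ in $Y$, the number of edges directed from $\{a,b\}$ to $\{c,d\}$ is even. Theorem. The class of all finite semigeneric tournaments has the extension property for partial automorphisms (EPPA): for every finite semigeneric tournament $A$ there is a finite semigeneric tournament $B$ that contains $A$ as a substructure (induced subgraph) such that every isomorphism between two substructures of $A$ extends to an automorphism of $B$. -/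

import Mathlib

namespace SemigenericEPPA

universe u

/-- A directed graph in the sense of one irreflexive and antisymmetric binary relation:
no loops, and no two vertices joined by edges in both directions. -/
structure IsDirectedGraph {V : Type u} (D : Digraph V) : Prop where
  loopless : ∀ x, ¬ D.Adj x x
  asymm : ∀ x y, D.Adj x y → ¬ D.Adj y x

/-- The fibres of `p : V → ι` (some of them possibly empty) are the parts of a partition of the
vertex set such that there are no edges inside a part, and any two vertices in different parts are
joined by an edge. -/
structure IsPartition {V : Type u} {ι : Type*} (D : Digraph V) (p : V → ι) : Prop where
  not_adj : ∀ x y, p x = p y → ¬ D.Adj x y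
  adj_or_adj : ∀ x y, p x ≠ p y → D.Adj x y ∨ D.Adj y x

/-- The set of edges of `D` that go from a vertex in `S` to a vertex in `T`. -/
def edgesFromTo {V : Type u} (D : Digraph V) (S T : Set V) : Set (V × V) :=
  {e | e.1 ∈ S ∧ e.2 ∈ T ∧ D.Adj e.1 e.2}

/-- The parity condition for a partition into parts `p ⁻¹' {i}`: for any two different parts, any
two distinct vertices `a, b` in the first and any two distinct vertices `c, d` in the second, the
number of edges going from `{a, b}` to `{c, d}` is even. -/
def ParityCondition {V : Type u} {ι : Type*} (D : Digraph V) (p : V → ι) : Prop :=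
  ∀ i j : ι, i ≠ j → ∀ a b c d : V, p a = i → p b = i → a ≠ b → p c = j → p d = j → c ≠ d →
    Even (edgesFromTo D {a, b} {c, d}).ncard

/-- A semigeneric tournament: an `ω`-partite tournament, with parts indexed by `ℕ` (and possibly
empty), that satisfies the parity condition. The non-empty parts are determined by `D`, being the
classes of the relation of not being adjacent, so it does not matter which partition is taken. -/
def IsSemigenericTournament {V : Type u} (D : Digraph V) : Prop :=
  IsDirectedGraph D ∧ ∃ p : V → ℕ, IsPartition D p ∧ ParityCondition D p

/-- The class of all finite semigeneric tournaments. -/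
def FiniteSemigenericTournament (V : Type u) (D : Digraph V) : Prop :=
  Finite V ∧ IsSemigenericTournament D

/-- A partial automorphism of `D`: an isomorphism between two substructures of `D`, that is,
between the subgraphs that two sets of vertices induce. -/
abbrev PartialAut {V : Type u} (D : Digraph V) (S T : Set V) : Type u :=
  Subrel D.Adj (· ∈ S) ≃r Subrel D.Adj (· ∈ T)

/-- `E` is an EPPA-witness of `D` via the embedding `e` (which identifies `D` with an induced
subgraph of `E`): every partial automorphism of `D` extends to an automorphism of `E`. -/
def IsEPPAWitness {V W : Type u} (D : Digraph V) (E : Digraph W) (e : D.Adj ↪r E.Adj) : Prop :=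
  ∀ (S T : Set V) (f : PartialAut D S T),
    ∃ g : E.Adj ≃r E.Adj, ∀ x : S, g (e (x : V)) = e (f x : V)

/-- A class of structures with one binary relation has the extension property for partial
automorphisms (EPPA) if each of its members has an EPPA-witness in the class. -/
def HasEPPA (C : ∀ V : Type u, Digraph V → Prop) : Prop :=
  ∀ (V : Type u) (D : Digraph V), C V D →
    ∃ (W : Type u) (E : Digraph W) (e : D.Adj ↪r E.Adj), C W E ∧ IsEPPAWitness D E e

end SemigenericEPPA

namespace SemigenericEPPA

/-! Over the two-element field, parity says that between parts `i` and `j` the direction from `x` to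
`y` splits into a function of `x` plus a function of `y`. With base points it becomes `φ_j(x) +
φ_i(y) + t`, where `t` is a tournament on the parts (`arc_eq_coordinate_add`).

The witness admits every function on `V` as a coordinate function of a part, and gives each vertex a
free valuation of the parts, which can absorb any change of coordinate functions and of `t`
(`vertexPerm_adj_iff`). The embedded vertices have valuation zero. Keeping it zero along a partial
automorphism prescribes some rows of the correction `d`; this is consistent because edges are
preserved, and `exists_add_swap_eq` fills in the rest. -/

open Classical in
/-- The indicator of adjacency, with values in the two-element field. -/
noncomputable def arc {V : Type*} (D : Digraph V) (x y : V) : ZMod 2 :=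
  if D.Adj x y then 1 else 0

theorem arc_eq_one_iff {V : Type*} {D : Digraph V} {x y : V} : arc D x y = 1 ↔ D.Adj x y := by
  unfold arc
  split_ifs with h <;> simp [h]

theorem arc_eq_arc_iff {V W : Type*} {D : Digraph V} {E : Digraph W} {x y : V} {x' y' : W} :
    arc D x y = arc E x' y' ↔ (D.Adj x y ↔ E.Adj x' y') := by
  unfold arc
  split_ifs with h h' h' <;> simp [h, h']

theorem cast_ncard_edgesFromTo {V : Type*} (D : Digraph V) {a b c d : V} (hab : a ≠ b)
    (hcd : c ≠ d) :
    ((edgesFromTo D {a, b} {c, d}).ncard : ZMod 2) =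
      arc D a c + arc D a d + (arc D b c + arc D b d) := by
  classical
  have h : edgesFromTo D {a, b} {c, d} =
      ((({a, b} : Finset V) ×ˢ ({c, d} : Finset V)).filter fun e => D.Adj e.1 e.2 :
        Finset (V × V)) := by
    ext e
    simp [edgesFromTo, and_assoc]
  rw [h, Set.ncard_coe_finset, Finset.card_filter, Nat.cast_sum, Finset.sum_product,
    Finset.sum_pair hab, Finset.sum_pair hcd, Finset.sum_pair hcd]
  simp [arc]

theorem IsPartition.arc_eq_zero {V ι : Type*} {D : Digraph V} {p : V → ι} (hp : IsPartition D p)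
    {x y : V} (h : p x = p y) : arc D x y = 0 := by
  simp [arc, hp.not_adj x y h]

theorem IsPartition.eq_iff {V ι : Type*} {D : Digraph V} {p : V → ι} (hp : IsPartition D p)
    (x y : V) : p x = p y ↔ ¬ D.Adj x y ∧ ¬ D.Adj y x := by
  refine ⟨fun h => ⟨hp.not_adj _ _ h, hp.not_adj _ _ h.symm⟩, fun h => ?_⟩
  by_contra hne
  exact (hp.adj_or_adj _ _ hne).elim h.1 h.2

theorem IsPartition.arc_swap {V ι : Type*} {D : Digraph V} {p : V → ι} (hp : IsPartition D p)
    (hD : IsDirectedGraph D) {x y : V} (h : p x ≠ p y) : arc D y x = arc D x y + 1 := by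
  unfold arc
  rcases hp.adj_or_adj x y h with h | h
  · rw [if_pos h, if_neg (hD.asymm _ _ h)]; decide
  · rw [if_pos h, if_neg (hD.asymm _ _ h)]; decide

theorem ParityCondition.arc_add {V ι : Type*} {D : Digraph V} {p : V → ι}
    (h : ParityCondition D p) {a b c d : V} (hab : p a = p b) (hcd : p c = p d)
    (hac : p a ≠ p c) : arc D a c = arc D a d + arc D b c + arc D b d := by
  by_cases h₁ : a = b
  · subst h₁; grind
  by_cases h₂ : c = d
  · subst h₂; grind
  have := (ZMod.natCast_eq_zero_iff_even).2
    (h _ _ hac a b c d rfl hab.symm h₁ rfl hcd.symm h₂)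
  rw [cast_ncard_edgesFromTo D h₁ h₂] at this
  grind

/-- Equal kernels give a bijection between the ranges, and finiteness extends it. Since `f` need not
be injective, this serves parts as well as vertices. -/
theorem exists_perm_extend {S α : Type*} [Finite α] (f g : S → α)
    (h : ∀ a b, f a = f b ↔ g a = g b) : ∃ π : Equiv.Perm α, ∀ a, π (f a) = g a := by
  classical
  have := Fintype.ofFinite α
  let r : {x // x ∈ Set.range f} → {x // x ∈ Set.range g} := fun y => ⟨g y.2.choose, _, rfl⟩
  have hr : ∀ a, r ⟨f a, a, rfl⟩ = ⟨g a, a, rfl⟩ := fun a =>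
    Subtype.ext ((h _ _).1 (Exists.choose_spec (⟨a, rfl⟩ : f a ∈ Set.range f)))
  have hbij : Function.Bijective r := by
    refine ⟨?_, ?_⟩
    · rintro ⟨_, a, rfl⟩ ⟨_, b, rfl⟩ hab
      rw [hr, hr] at hab
      exact Subtype.ext ((h _ _).2 (congrArg Subtype.val hab))
    · rintro ⟨_, a, rfl⟩
      exact ⟨_, hr a⟩
  refine ⟨(Equiv.ofBijective r hbij).extendSubtype, fun a => ?_⟩
  rw [Equiv.extendSubtype_apply_of_mem _ _ ⟨a, rfl⟩, Equiv.ofBijective_apply, hr]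

/-- Prescribed values on a set `A` of points extend to a solution of `d p q + d q p = s p q`. -/
theorem exists_add_swap_eq {P : Type*} (t s h : P → P → ZMod 2) (A : Set P)
    (ht : ∀ p q, p ≠ q → t p q + t q p = 1) (hs : ∀ p q, p ≠ q → s q p = s p q)
    (hh : ∀ p ∈ A, ∀ q ∈ A, p ≠ q → h p q + h q p = s p q) :
    ∃ d : P → P → ZMod 2, (∀ p ∈ A, ∀ q, d p q = h p q) ∧
      ∀ p q, p ≠ q → d p q + d q p = s p q := by
  classical
  -- If only `q` is in `A`, the value is forced. If neither is, `t` selects which of the two orders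
  -- carries `s p q`.
  refine ⟨fun p q => if p ∈ A then h p q else if q ∈ A then s p q + h q p else s p q * t p q,
    fun p hp q => if_pos hp, fun p q hpq => ?_⟩
  have h₁ := ht p q hpq
  have h₂ := hs p q hpq
  have h₃ := hh p
  dsimp only
  split_ifs <;> grind

/-! ### The witness and its automorphisms -/

/-- The parts of the witness: a part of the given graph with a function on its vertices. -/
abbrev WitnessPart (V I : Type*) := I × (V → ZMod 2)

/-- The vertices of the witness. -/
abbrev WitnessVertex (V I : Type*) := WitnessPart V I × V × (WitnessPart V I → ZMod 2)

section Witness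

variable {V I : Type*}

/-- The direction between two vertices of the witness in different parts, relative to a
tournament `t` on the parts. -/
def witnessArc (t : WitnessPart V I → WitnessPart V I → ZMod 2) (v w : WitnessVertex V I) :
    ZMod 2 :=
  w.1.2 v.2.1 + v.2.2 w.1 + (v.1.2 w.2.1 + w.2.2 v.1) + t v.1 w.1

/-- The witness graph relative to a tournament `t` on the parts. -/
def witness (t : WitnessPart V I → WitnessPart V I → ZMod 2) : Digraph (WitnessVertex V I) where
  Adj v w := v.1 ≠ w.1 ∧ witnessArc t v w = 1

theorem witness_adj {t : WitnessPart V I → WitnessPart V I → ZMod 2} {v w : WitnessVertex V I} :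
    (witness t).Adj v w ↔ v.1 ≠ w.1 ∧ witnessArc t v w = 1 := Iff.rfl

theorem arc_witness (t : WitnessPart V I → WitnessPart V I → ZMod 2) {v w : WitnessVertex V I}
    (h : v.1 ≠ w.1) : arc (witness t) v w = witnessArc t v w := by
  have hz : ∀ z : ZMod 2, (if z = 1 then (1 : ZMod 2) else 0) = z := by decide
  simp only [arc, witness_adj, h, ne_eq, not_false_eq_true, true_and]
  convert hz _

theorem isSemigenericTournament_witness [Finite V] [Finite I]
    {t : WitnessPart V I → WitnessPart V I → ZMod 2}
    (ht : ∀ p q, p ≠ q → t p q + t q p = 1) : IsSemigenericTournament (witness t) := by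
  obtain ⟨n, ⟨e⟩⟩ := Finite.exists_equiv_fin (WitnessPart V I)
  have hswap : ∀ v w : WitnessVertex V I, v.1 ≠ w.1 →
      witnessArc t v w + witnessArc t w v = 1 := fun v w h => by
    have := ht _ _ h
    unfold witnessArc
    grind
  have hcode : ∀ v w : WitnessVertex V I, (e v.1 : ℕ) = e w.1 ↔ v.1 = w.1 := fun v w => by
    rw [Fin.val_inj, e.apply_eq_iff_eq]
  refine ⟨⟨fun v h => h.1 rfl, fun v w h h' => ?_⟩, fun v => e v.1,
    ⟨fun v w h h' => h'.1 ((hcode v w).1 h), fun v w h => ?_⟩, ?_⟩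
  · have := hswap v w h.1
    rw [h.2, h'.2] at this
    exact absurd this (by decide)
  · have hne := fun h' => h ((hcode v w).2 h')
    have key : ∀ a b : ZMod 2, a + b = 1 → a = 1 ∨ b = 1 := by decide
    exact (key _ _ (hswap v w hne)).imp (fun h => ⟨hne, h⟩) (fun h => ⟨Ne.symm hne, h⟩)
  · intro i j hij a b c d ha hb hab hc hd hcd
    have h₁ : a.1 = b.1 := (hcode _ _).1 (ha.trans hb.symm)
    have h₂ : c.1 = d.1 := (hcode _ _).1 (hc.trans hd.symm)
    have hne : a.1 ≠ c.1 := fun h => hij (ha.symm.trans (((hcode _ _).2 h).trans hc))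
    rw [← ZMod.natCast_eq_zero_iff_even, cast_ncard_edgesFromTo _ hab hcd, arc_witness _ hne,
      arc_witness _ (h₂ ▸ hne), arc_witness _ (h₁ ▸ hne), arc_witness _ (h₁ ▸ h₂ ▸ hne)]
    -- For fixed parts, the direction is a sum of one term per endpoint and a constant, so
    -- everything cancels in pairs.
    unfold witnessArc
    rw [← h₁, ← h₂]
    grind

/-- The permutation of the parts of the witness given by a permutation `σ` of the vertices and a
permutation `π` of the parts of the given graph, with correction `c`. -/
def partPerm (σ : Equiv.Perm V) (π : Equiv.Perm I) (c : I → V → ZMod 2) :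
    Equiv.Perm (WitnessPart V I) where
  toFun p := (π p.1, fun y => p.2 (σ.symm y) + c p.1 (σ.symm y))
  invFun p := (π.symm p.1, fun y => p.2 (σ y) + c (π.symm p.1) y)
  left_inv p := by
    ext <;> simp [add_assoc, CharTwo.add_self_eq_zero]
  right_inv p := by
    ext <;> simp [add_assoc, CharTwo.add_self_eq_zero]

theorem partPerm_apply_snd (σ : Equiv.Perm V) (π : Equiv.Perm I) (c : I → V → ZMod 2)
    (p : WitnessPart V I) (x : V) : (partPerm σ π c p).2 (σ x) = p.2 x + c p.1 x := by
  simp [partPerm]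

/-- The permutation of the vertices of the witness over `partPerm σ π c`, with correction `d`. -/
def vertexPerm (σ : Equiv.Perm V) (π : Equiv.Perm I) (c : I → V → ZMod 2)
    (d : WitnessPart V I → WitnessPart V I → ZMod 2) : Equiv.Perm (WitnessVertex V I) where
  toFun v := (partPerm σ π c v.1, σ v.2.1, fun q =>
    v.2.2 ((partPerm σ π c).symm q) + (c ((partPerm σ π c).symm q).1 v.2.1 +
      d v.1 ((partPerm σ π c).symm q)))
  invFun v := ((partPerm σ π c).symm v.1, σ.symm v.2.1, fun q =>
    v.2.2 (partPerm σ π c q) + (c q.1 (σ.symm v.2.1) + d ((partPerm σ π c).symm v.1) q))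
  left_inv v := by
    refine Prod.ext (by simp) (Prod.ext (by simp) (funext fun q => ?_))
    simp [add_assoc, CharTwo.add_self_eq_zero]
  right_inv v := by
    refine Prod.ext (by simp) (Prod.ext (by simp) (funext fun q => ?_))
    simp [add_assoc, CharTwo.add_self_eq_zero]

/-- The change `c` of the part functions cancels against the same `c` in the valuations; `d` then
cancels the change of `t`. -/
theorem vertexPerm_adj_iff {t : WitnessPart V I → WitnessPart V I → ZMod 2} {σ : Equiv.Perm V}
    {π : Equiv.Perm I} {c : I → V → ZMod 2} {d : WitnessPart V I → WitnessPart V I → ZMod 2}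
    (hd : ∀ p q, p ≠ q → d p q + d q p = t p q + t (partPerm σ π c p) (partPerm σ π c q))
    (v w : WitnessVertex V I) :
    (witness t).Adj (vertexPerm σ π c d v) (vertexPerm σ π c d w) ↔ (witness t).Adj v w := by
  have hne : (vertexPerm σ π c d v).1 ≠ (vertexPerm σ π c d w).1 ↔ v.1 ≠ w.1 :=
    (partPerm σ π c).apply_eq_iff_eq.not
  rw [witness_adj, witness_adj, hne]
  refine and_congr_right fun h => ?_
  have := hd _ _ h
  suffices h' : witnessArc t (vertexPerm σ π c d v) (vertexPerm σ π c d w) = witnessArc t v w by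
    rw [h']
  simp only [witnessArc, vertexPerm, Equiv.coe_fn_mk, partPerm_apply_snd, Equiv.symm_apply_apply]
  grind

end Witness

/-- There is a tournament on the parts of the witness that extends the order on the parts. -/
theorem exists_tournament (V I : Type*) [LinearOrder I] :
    ∃ t : WitnessPart V I → WitnessPart V I → ZMod 2,
      (∀ p q, p ≠ q → t p q + t q p = 1) ∧ ∀ p q, p.1 < q.1 → t p q = 1 := by
  classical
  let : LinearOrder (V → ZMod 2) := linearOrderOfSTO WellOrderingRel
  refine ⟨fun p q => if toLex p < toLex q then 1 else 0, fun p q h => ?_, fun p q h => ?_⟩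
  · rcases lt_or_gt_of_ne (toLex.injective.ne h) with h | h
    · simp [h, h.not_gt]
    · simp [h, h.not_gt]
  · exact if_pos ((Prod.Lex.toLex_lt_toLex).2 (Or.inl h))

/-! ### Coordinates from base points -/

open Classical in
/-- Coordinates of a semigeneric tournament relative to base points `b` of its parts. -/
noncomputable def coordinate {V I : Type*} [LinearOrder I] (D : Digraph V) (p : V → I) (b : I → V)
    (j : I) (x : V) : ZMod 2 :=
  arc D x (b j) + if p x < j then arc D (b (p x)) (b j) else 0

section Coordinate

variable {V I : Type*} [LinearOrder I] {D : Digraph V} {p : V → I} {b : I → V}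

theorem coordinate_self (hp : IsPartition D p) (hb : ∀ i, p (b i) = i) (x : V) :
    coordinate D p b (p x) x = 0 := by
  simp [coordinate, hp.arc_eq_zero (hb (p x)).symm]

/-- Parity for `x`, `y` and the base points of their parts; the `1` comes from reversing the edge
between `b (p x)` and `y`. -/
theorem arc_eq_of_lt (hD : IsDirectedGraph D) (hp : IsPartition D p) (hpar : ParityCondition D p)
    (hb : ∀ i, p (b i) = i) {x y : V} (h : p x < p y) :
    arc D x y = coordinate D p b (p y) x + coordinate D p b (p x) y + 1 := by
  have h₁ := hpar.arc_add (a := x) (b := b (p x)) (c := y) (d := b (p y)) (hb _).symm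
    (hb _).symm h.ne
  have h₂ : arc D y (b (p x)) = arc D (b (p x)) y + 1 :=
    hp.arc_swap hD (by rw [hb]; exact h.ne)
  rw [coordinate, coordinate, if_pos h, if_neg h.not_gt, h₂, h₁]
  grind

theorem arc_eq_coordinate_add (hD : IsDirectedGraph D) (hp : IsPartition D p)
    (hpar : ParityCondition D p) (hb : ∀ i, p (b i) = i)
    {t : WitnessPart V I → WitnessPart V I → ZMod 2} (ht : ∀ p q, p ≠ q → t p q + t q p = 1)
    (ht' : ∀ p q, p.1 < q.1 → t p q = 1) {x y : V} (h : p x ≠ p y) :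
    arc D x y = coordinate D p b (p y) x + coordinate D p b (p x) y +
      t (p x, coordinate D p b (p x)) (p y, coordinate D p b (p y)) := by
  rcases lt_or_gt_of_ne h with h' | h'
  · rw [arc_eq_of_lt hD hp hpar hb h', ht' _ _ h']
  · have h₁ := ht (p x, coordinate D p b (p x)) (p y, coordinate D p b (p y))
      fun h'' => h (congrArg Prod.fst h'')
    have h₂ := hp.arc_swap hD h
    rw [arc_eq_of_lt hD hp hpar hb h'] at h₂
    rw [ht' (p y, _) (p x, _) h'] at h₁
    grind

end Coordinate

/-! ### Embedding and extension of partial automorphisms -/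

/-- The vertex of the witness that represents a vertex of the given graph. -/
noncomputable def toWitness {V I : Type*} [LinearOrder I] (D : Digraph V) (p : V → I) (b : I → V)
    (x : V) : WitnessVertex V I :=
  ((p x, coordinate D p b (p x)), x, 0)

section Embedding

variable {V : Type u} {I : Type*} [LinearOrder I] {D : Digraph V} {p : V → I} {b : I → V}
  {t : WitnessPart V I → WitnessPart V I → ZMod 2}

theorem toWitness_adj_iff (hD : IsDirectedGraph D) (hp : IsPartition D p)
    (hpar : ParityCondition D p) (hb : ∀ i, p (b i) = i)
    (ht : ∀ p q, p ≠ q → t p q + t q p = 1) (ht' : ∀ p q, p.1 < q.1 → t p q = 1) (x y : V) :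
    (witness t).Adj (toWitness D p b x) (toWitness D p b y) ↔ D.Adj x y := by
  by_cases h : p x = p y
  · refine iff_of_false (fun h' => h'.1 ?_) (hp.not_adj _ _ h)
    simp only [toWitness, h]
  · rw [witness_adj, ← arc_eq_one_iff, arc_eq_coordinate_add hD hp hpar hb ht ht' h]
    have hne : (toWitness D p b x).1 ≠ (toWitness D p b y).1 := fun h' => h (congrArg Prod.fst h')
    simp only [hne, ne_eq, not_false_eq_true, true_and]
    simp [witnessArc, toWitness]

theorem exists_relIso_extend [Finite V] [Finite I] (hD : IsDirectedGraph D)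
    (hp : IsPartition D p) (hpar : ParityCondition D p) (hb : ∀ i, p (b i) = i)
    (ht : ∀ p q, p ≠ q → t p q + t q p = 1) (ht' : ∀ p q, p.1 < q.1 → t p q = 1)
    {S T : Set V} (f : PartialAut D S T) :
    ∃ g : (witness t).Adj ≃r (witness t).Adj,
      ∀ x : S, g (toWitness D p b x) = toWitness D p b (f x : V) := by
  classical
  have hadj : ∀ x y : S, D.Adj (f x : V) (f y) ↔ D.Adj (x : V) y := fun x y => f.map_rel_iff
  have hpart : ∀ x y : S, p x = p y ↔ p (f x : V) = p (f y) := fun x y => by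
    rw [hp.eq_iff, hp.eq_iff, hadj, hadj]
  obtain ⟨π, hπ⟩ := exists_perm_extend (fun x : S => p x) (fun x : S => p (f x : V)) hpart
  obtain ⟨σ, hσ⟩ := exists_perm_extend (fun x : S => (x : V)) (fun x : S => (f x : V))
    fun x y => by rw [← Subtype.ext_iff, ← Subtype.ext_iff, f.injective.eq_iff]
  set φ := coordinate D p b with hφ
  -- Chosen so that the embedded parts meeting `S` go to embedded parts (`hF`).
  let c : I → V → ZMod 2 := fun i x => if ∃ a : S, p a = i then φ (π i) (σ x) + φ i x else 0
  have hc : ∀ (a : S) (x : V), c (p a) x = φ (p (f a : V)) (σ x) + φ (p a) x := fun a x => by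
    rw [← hπ]
    exact if_pos ⟨a, rfl⟩
  have hF : ∀ a : S, partPerm σ π c (p a, φ (p a)) = (p (f a : V), φ (p (f a : V))) := fun a => by
    refine Prod.ext (hπ a) (funext fun y => ?_)
    obtain ⟨x, rfl⟩ := σ.surjective y
    rw [partPerm_apply_snd, hc]
    grind
  have hcc : ∀ x y : S, p x ≠ p y → c (p y) x + c (p x) y =
      t (p x, φ (p x)) (p y, φ (p y)) +
        t (p (f x : V), φ (p (f x : V))) (p (f y : V), φ (p (f y : V))) := fun x y h => by
    have h₁ := arc_eq_coordinate_add hD hp hpar hb ht ht' h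
    have h₂ := arc_eq_coordinate_add hD hp hpar hb ht ht' ((hpart x y).not.1 h)
    rw [arc_eq_arc_iff.2 (hadj x y)] at h₂
    rw [hc, hc, hσ, hσ]
    grind
  -- This makes the prescribed row of `d` depend on the part alone. By `hcc`, `c (p a) x + c (p x)
  -- a` depends only on the parts of `x` and `a`.
  have hconst : ∀ x y : S, p x = p y → ∀ j, c j x = c j y := fun x y h j => by
    by_cases hj : ∃ a : S, p a = j
    · obtain ⟨a, rfl⟩ := hj
      by_cases ha : p x = p a
      · have h₁ : ∀ z : S, p z = p a → c (p a) z = 0 := fun z hz => by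
          rw [hc, hσ, ← (hpart z a).1 hz, ← hz, hφ, coordinate_self hp hb, coordinate_self hp hb,
            add_zero]
        rw [h₁ x ha, h₁ y (h ▸ ha)]
      · have h₁ := hcc x a ha
        have h₂ := hcc y a (h ▸ ha)
        rw [← h, ← (hpart x y).1 h, ← h₁] at h₂
        exact (add_right_cancel h₂).symm
    · exact (if_neg hj).trans (if_neg hj).symm
  -- A representative in `S` of each part that meets `S`; the value `b i` elsewhere is a dummy.
  have hrep : ∀ i, ∃ v : V, ∀ a : S, p a = i → ∃ a' : S, (a' : V) = v ∧ p a' = i := fun i => by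
    by_cases hi : ∃ a : S, p a = i
    · obtain ⟨a, ha⟩ := hi
      exact ⟨a, fun _ _ => ⟨a, rfl, ha⟩⟩
    · exact ⟨b i, fun a ha => absurd ⟨a, ha⟩ hi⟩
  choose r hr using hrep
  have hcr : ∀ (a : S) j, c j (r (p a)) = c j a := fun a j => by
    obtain ⟨a', h₁, h₂⟩ := hr _ a rfl
    rw [← h₁, hconst a' a h₂]
  obtain ⟨d, hd₁, hd₂⟩ := exists_add_swap_eq t
    (fun P Q => t P Q + t (partPerm σ π c P) (partPerm σ π c Q))
    (fun P Q => c Q.1 (r P.1)) (Set.range fun a : S => (p a, φ (p a))) ht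
    (fun P Q h => by
      have h₁ := ht P Q h
      have h₂ := ht _ _ ((partPerm σ π c).injective.ne h)
      grind)
    (by
      rintro _ ⟨x, rfl⟩ _ ⟨y, rfl⟩ h
      dsimp only
      rw [hcr, hcr, hF, hF]
      exact hcc x y fun h' => h (by simp only [h']))
  refine ⟨⟨vertexPerm σ π c d, fun {v w} => vertexPerm_adj_iff hd₂ v w⟩, fun x => ?_⟩
  refine Prod.ext (hF x) (Prod.ext (hσ x) (funext fun q => ?_))
  obtain ⟨q, rfl⟩ := (partPerm σ π c).surjective q
  have h := hd₁ _ ⟨x, rfl⟩ q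
  dsimp only at h
  rw [hcr] at h
  simp [vertexPerm, toWitness, ← hφ, h, CharTwo.add_self_eq_zero]

end Embedding

end SemigenericEPPA

open SemigenericEPPA in
theorem theorem1p2 :
    SemigenericEPPA.HasEPPA SemigenericEPPA.FiniteSemigenericTournament := by
  rintro V D ⟨hV, hD, p, hp, hpar⟩
  -- Dropping the empty parts leaves finitely many, each with a base point.
  let p' : V → Set.range p := Set.rangeFactorization p
  have hp' : ∀ x y, p' x = p' y ↔ p x = p y := fun x y => Subtype.ext_iff
  have hpart : IsPartition D p' :=
    ⟨fun x y h => hp.not_adj x y ((hp' x y).1 h), fun x y h => hp.adj_or_adj x y ((hp' x y).not.1 h)⟩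
  have hpar' : ParityCondition D p' := by
    intro i j hij a b c d ha hb hab hc hd hcd
    exact hpar i j (fun h => hij (Subtype.ext h)) a b c d (congrArg Subtype.val ha)
      (congrArg Subtype.val hb) hab (congrArg Subtype.val hc) (congrArg Subtype.val hd) hcd
  obtain ⟨b, hb⟩ := (Set.rangeFactorization_surjective (f := p)).hasRightInverse
  obtain ⟨t, ht, ht'⟩ := exists_tournament V (Set.range p)
  refine ⟨WitnessVertex V (Set.range p), witness t,
    ⟨⟨toWitness D p' b, fun x y h => congrArg (fun v => v.2.1) h⟩,
      fun {x y} => toWitness_adj_iff hD hpart hpar' hb ht ht' x y⟩,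
    ⟨inferInstance, isSemigenericTournament_witness ht⟩, fun S T f => ?_⟩
  exact exists_relIso_extend hD hpart hpar' hb ht ht' f
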